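/- Let $A$ be a commutative semiring (with $0$ and $1$), and let $X=\operatorname{Spec}A$ be the set of its prime ideals with the Zariski topology, whose principal open sets are $D(a)=\{\mathfrak p\in X\mid a\notin\mathfrak p\}$ for $a\in A$. For an open set $U\subseteq X$ let $S_U=\{b\in A\mid U\subseteq D(b)\}$, a multiplicative submonoid of $A$, and write $S_a=S_{D(a)}$. Let $A_a=A[a^{-1}]$ and $A_{\mathfrak p}=(A\setminus\mathfrak p)^{-1}A$. Let $\mathcal F$ be the presheaf of commutative semirings $\mathcal F(U)=S_U^{-1}A$ on $X$, with restriction maps $x/s\mapsto x/s$. Consider the following three constructions. (A) $\mathcal O^A=\mathcal F^{\#}$, the sheafification of $\mathcal F$, with its canonical morphism $\eta^A\colon\mathcal F\to\mathcal F^{\#}$. (B) $\mathcal O^B$, the extension to all open sets of $D(a)\mapsto S_a^{-1}A$, that is $$\mathcal O^B(U)=\operatorname{Eq}\Big(\prod_{i\in I}S_{a_i}^{-1}A\rightrightarrows\prod_{i,j\in I}S_{a_ia_j}^{-1}A\Big),$$ where $(a_i)_{i\in I}$ is the family of all $a\in A$ with $D(a)\subseteq U$. Restriction maps are the projections, and $\eta^B\colon\mathcal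 F\to\mathcal O^B$ sends a section to the family of its restrictions. (C) $\mathcal O^C(U)$ is the semiring of functions $s\colon U\to\coprod_{\mathfrak p\in U}A_{\mathfrak p}$ with $s(\mathfrak p)\in A_{\mathfrak p}$ such that every $\mathfrak p\in U$ has an open neighbourhood $V\subseteq U$ and elements $x,f\in A$ with $f\notin\mathfrak q$ and $s(\mathfrak q)=x/f$ in $A_{\mathfrak q}$ for all $\mathfrak q\in V$. Restriction maps are restriction of functions, and $\eta^C\colon\mathcal F\to\mathcal O^C$ sends $x/f$ to $\mathfrak p\mapsto x/f$. **Theorem.** $\mathcal O^A$, $\mathcal O^B$ and $\mathcal O^C$ are sheaves of commutative semirings on $X$. In (B), for every open $U$ and every covering $U=\bigcup_{i\in I}D(a_i)$ by principal open sets, projection of families is an isomorphism from $\mathcal O^B(U)$ onto the equalizer displayed above for that covering; so the construction does not depend on the covering. The three sheaves are isomorphic: there are isomorphisms $\mathcal O^A\cong\mathcal O^B$, $\mathcal O^A\cong\mathcal O^C$ and $\mathcal O^B\cong\mathcal O^C$ of (pre)sheaves of semirings that are compatible with $\eta^A,\eta^B,\eta^C$. Moreover, if $\mathcal O$ is any of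 the three, with its morphism $\eta\colon\mathcal F\to\mathcal O$, then: 1. for every $a\in A$, the natural morphism $A_a\to S_a^{-1}A\xrightarrow{\ \eta\ }\mathcal O(D(a))$ is an isomorphism; 2. the natural morphism $A\to S_X^{-1}A\xrightarrow{\ \eta\ }\mathcal O(X)$ is an isomorphism; 3. for every $\mathfrak p\in X$, there is an isomorphism from $A_{\mathfrak p}$ to the stalk $\mathcal O_{\mathfrak p}$ that is compatible with the natural morphisms from $A$, and $\mathcal O_{\mathfrak p}$ is a local semiring. -/

import Mathlib

open CategoryTheory TopologicalSpace Opposite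

universe u v

namespace SemiringSpec

noncomputable section

/-! ## Filtered colimits, sheafification and stalks for commutative semirings -/

instance hasColimitsOfShape_of_isFiltered (J : Type u) [SmallCategory J] [IsFiltered J] :
    Limits.HasColimitsOfShape J CommSemiRingCat.{u} where
  has_colimit F :=
    ⟨⟨⟨CommSemiRingCat.FilteredColimits.colimitCocone.{u, u} F,
      CommSemiRingCat.FilteredColimits.colimitCoconeIsColimit.{u, u} F⟩⟩⟩

instance hasWeakSheafify (X : TopCat.{u}) :
    HasWeakSheafify (Opens.grothendieckTopology X) CommSemiRingCat.{u} :=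
  inferInstance

/-- The stalk at `x` of a presheaf of commutative semirings: the (filtered) colimit of its sections
over the open neighbourhoods of `x`. -/
def stalk {X : TopCat.{u}} (G : TopCat.Presheaf CommSemiRingCat.{u} X) (x : X) :
    CommSemiRingCat.{u} :=
  Limits.colimit ((OpenNhds.inclusion x).op ⋙ G)

/-- The germ at `x` of a global section. -/
def germTop {X : TopCat.{u}} (G : TopCat.Presheaf CommSemiRingCat.{u} X) (x : X) :
    G.obj (op ⊤) ⟶ stalk G x :=
  Limits.colimit.ι ((OpenNhds.inclusion x).op ⋙ G) (op (⊤ : OpenNhds x))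

variable (A : Type u) [CommSemiring A]

/-- The prime spectrum of the semiring `A` with its Zariski topology. -/
abbrev specTop : TopCat.{u} := TopCat.of (PrimeSpectrum A)

/-! ## The presheaf of localizations -/

variable {A}

/-- `S_U = {b ∈ A ∣ U ⊆ D(b)}`. -/
def nonvanishing (U : Opens (PrimeSpectrum A)) : Submonoid A where
  carrier := {b | U ≤ PrimeSpectrum.basicOpen b}
  one_mem' := by simp
  mul_mem' {a b} ha hb := by
    simp only [Set.mem_ofPred_eq] at ha hb ⊢
    rw [PrimeSpectrum.basicOpen_mul]
    exact le_inf ha hb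

theorem nonvanishing_mono {U V : Opens (PrimeSpectrum A)} (h : V ≤ U) :
    nonvanishing U ≤ nonvanishing V :=
  fun _ hb => le_trans h hb

theorem nonvanishing_le_primeCompl {U : Opens (PrimeSpectrum A)} {p : PrimeSpectrum A}
    (hp : p ∈ U) : nonvanishing U ≤ p.asIdeal.primeCompl :=
  fun _ hb => hb hp

/-- `S_U⁻¹ A`. -/
abbrev Loc (U : Opens (PrimeSpectrum A)) : Type u := Localization (nonvanishing U)

/-- The restriction `S_U⁻¹ A → S_V⁻¹ A`, `a / s ↦ a / s`, for `V ⊆ U`. -/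
def locRes {U V : Opens (PrimeSpectrum A)} (h : V ≤ U) : Loc U →+* Loc V :=
  IsLocalization.map (M := nonvanishing U) (T := nonvanishing V) (Loc V) (RingHom.id A)
    (nonvanishing_mono h)

theorem locRes_algebraMap {U V : Opens (PrimeSpectrum A)} (h : V ≤ U) (x : A) :
    locRes h (algebraMap A (Loc U) x) = algebraMap A (Loc V) x :=
  IsLocalization.map_eq (T := nonvanishing V) (Q := Loc V) (g := RingHom.id A)
    (nonvanishing_mono h) x

theorem locRes_comp {U V W : Opens (PrimeSpectrum A)} (h : V ≤ U) (k : W ≤ V) :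
    (locRes k).comp (locRes h) = locRes (k.trans h) := by
  apply IsLocalization.ringHom_ext (nonvanishing U)
  ext x
  simp [locRes_algebraMap]

theorem locRes_locRes {U V W : Opens (PrimeSpectrum A)} (h : V ≤ U) (k : W ≤ V) (x : Loc U) :
    locRes k (locRes h x) = locRes (k.trans h) x :=
  RingHom.congr_fun (locRes_comp h k) x

theorem locRes_id (U : Opens (PrimeSpectrum A)) : locRes (le_refl U) = RingHom.id (Loc U) := by
  apply IsLocalization.ringHom_ext (nonvanishing U)
  ext x
  simp [locRes_algebraMap]

variable (A) in
/-- The presheaf `U ↦ S_U⁻¹ A`. -/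
def locPresheaf : TopCat.Presheaf CommSemiRingCat.{u} (specTop A) where
  obj U := CommSemiRingCat.of (Loc (A := A) U.unop)
  map f := CommSemiRingCat.ofHom (locRes f.unop.le)
  map_id U := by
    ext1
    exact locRes_id _
  map_comp f g := by
    ext1
    exact (locRes_comp f.unop.le g.unop.le).symm

/-! ## First construction: sheafification of the presheaf of localizations -/

variable (A) in
/-- The sheafification of `U ↦ S_U⁻¹ A`. -/
def sheafA : TopCat.Presheaf CommSemiRingCat.{u} (specTop A) :=
  sheafify (Opens.grothendieckTopology (specTop A)) (locPresheaf A)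

variable (A) in
/-- The canonical morphism from the presheaf of localizations to its sheafification. -/
def toSheafA : locPresheaf A ⟶ sheafA A :=
  toSheafify (Opens.grothendieckTopology (specTop A)) (locPresheaf A)

/-! ## Second construction: extension from the principal open sets -/

/-- For a family `(a i)` of elements of `A`, the equalizer of
`∏ i, S_{a i}⁻¹ A ⇉ ∏ i j, S_{a i * a j}⁻¹ A`, where `S_a = S_{D(a)}`. -/
def principalEqualizer {ι : Type v} (a : ι → A) :
    Subsemiring (∀ i, Loc (PrimeSpectrum.basicOpen (a i))) where
  carrier := {s | ∀ i j,
    locRes (PrimeSpectrum.basicOpen_mul_le_left (a i) (a j)) (s i) =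
      locRes (PrimeSpectrum.basicOpen_mul_le_right (a i) (a j)) (s j)}
  zero_mem' i j := by simp
  one_mem' i j := by simp
  add_mem' {s t} hs ht i j := by simp [hs i j, ht i j]
  mul_mem' {s t} hs ht i j := by simp [hs i j, ht i j]

/-- Projection of compatible families along a reindexing map. -/
def principalEqualizerMap {ι : Type u} {κ : Type v} (a : ι → A) (f : κ → ι) :
    principalEqualizer a →+* principalEqualizer (fun k => a (f k)) where
  toFun s := ⟨fun k => s.1 (f k), fun i j => s.2 (f i) (f j)⟩
  map_zero' := rfl
  map_one' := rfl
  map_add' _ _ := rfl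
  map_mul' _ _ := rfl

/-- The sections over `U` of the extension: the equalizer attached to the covering of `U`
by all the principal open sets contained in it. -/
abbrev SectionsB (U : Opens (PrimeSpectrum A)) :=
  principalEqualizer (fun a : {a : A // PrimeSpectrum.basicOpen a ≤ U} => a.1)

variable (A) in
/-- The extension to all open sets of `D(a) ↦ S_a⁻¹ A`. -/
def sheafB : TopCat.Presheaf CommSemiRingCat.{u} (specTop A) where
  obj U := CommSemiRingCat.of (SectionsB (A := A) U.unop)
  map {U V} f := CommSemiRingCat.ofHom
    (principalEqualizerMap (fun a : {a : A // PrimeSpectrum.basicOpen a ≤ U.unop} => a.1)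
      (fun a : {a : A // PrimeSpectrum.basicOpen a ≤ V.unop} => ⟨a.1, a.2.trans f.unop.le⟩))
  map_id _ := rfl
  map_comp _ _ := rfl

/-- Given principal open sets `D(a i) ⊆ U`, the restriction of a section over `U` of the extension
to the compatible family of its components on the `D(a i)`. -/
def sectionsBToEqualizer (U : Opens (PrimeSpectrum A)) {ι : Type v} (a : ι → A)
    (h : ∀ i, PrimeSpectrum.basicOpen (a i) ≤ U) :
    SectionsB U →+* principalEqualizer a :=
  principalEqualizerMap (fun a : {a : A // PrimeSpectrum.basicOpen a ≤ U} => a.1)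
    (fun i => ⟨a i, h i⟩)

/-- `S_U⁻¹ A → O(U)`, sending `x` to the family of its restrictions. -/
def locToSectionsB (U : Opens (PrimeSpectrum A)) : Loc U →+* SectionsB U where
  toFun x := ⟨fun a => locRes a.2 x, fun i j => by simp only [locRes_locRes]⟩
  map_zero' := by ext; simp
  map_one' := by ext; simp
  map_add' _ _ := by ext; simp
  map_mul' _ _ := by ext; simp

variable (A) in
/-- The canonical morphism from the presheaf of localizations to the extension. -/
def toSheafB : locPresheaf A ⟶ sheafB A where
  app U := CommSemiRingCat.ofHom (locToSectionsB (A := A) U.unop)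
  naturality U V f := by
    ext x
    refine Subtype.ext (funext fun a => ?_)
    exact locRes_locRes f.unop.le a.2 x

/-! ## Third construction: functions that are locally quotients -/

/-- The functions `s` with `s 𝔭 ∈ A_𝔭` for `𝔭 ∈ U` that are locally quotients of elements
of `A`. -/
def sectionsC (U : Opens (PrimeSpectrum A)) :
    Subsemiring (∀ p : U, Localization.AtPrime p.1.asIdeal) where
  carrier := {s | ∀ p : U, ∃ (V : Opens (PrimeSpectrum A)) (_ : p.1 ∈ V) (hVU : V ≤ U) (a f : A),
    ∀ (q : PrimeSpectrum A) (hq : q ∈ V), ∃ hf : f ∉ q.asIdeal,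
      s ⟨q, hVU hq⟩ = IsLocalization.mk' (Localization.AtPrime q.asIdeal) a
        (⟨f, hf⟩ : q.asIdeal.primeCompl)}
  zero_mem' p := ⟨U, p.2, le_rfl, 0, 1, fun q _ =>
    ⟨q.asIdeal.primeCompl.one_mem, by simp⟩⟩
  one_mem' p := ⟨U, p.2, le_rfl, 1, 1, fun q _ =>
    ⟨q.asIdeal.primeCompl.one_mem, (IsLocalization.mk'_one _ _).trans (map_one _) |>.symm⟩⟩
  add_mem' {s t} hs ht p := by
    obtain ⟨V, hpV, hVU, a, f, h⟩ := hs p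
    obtain ⟨W, hpW, hWU, b, g, k⟩ := ht p
    refine ⟨V ⊓ W, ⟨hpV, hpW⟩, inf_le_left.trans hVU, a * g + b * f, f * g, fun q hq => ?_⟩
    obtain ⟨hf, e⟩ := h q hq.1
    obtain ⟨hg, e'⟩ := k q hq.2
    refine ⟨q.asIdeal.primeCompl.mul_mem hf hg, ?_⟩
    rw [Pi.add_apply, e, e']
    exact (IsLocalization.mk'_add a b ⟨f, hf⟩ ⟨g, hg⟩).symm
  mul_mem' {s t} hs ht p := by
    obtain ⟨V, hpV, hVU, a, f, h⟩ := hs p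
    obtain ⟨W, hpW, hWU, b, g, k⟩ := ht p
    refine ⟨V ⊓ W, ⟨hpV, hpW⟩, inf_le_left.trans hVU, a * b, f * g, fun q hq => ?_⟩
    obtain ⟨hf, e⟩ := h q hq.1
    obtain ⟨hg, e'⟩ := k q hq.2
    refine ⟨q.asIdeal.primeCompl.mul_mem hf hg, ?_⟩
    rw [Pi.mul_apply, e, e']
    exact (IsLocalization.mk'_mul _ a b ⟨f, hf⟩ ⟨g, hg⟩).symm

/-- Restriction of functions. -/
def sectionsCRes {U V : Opens (PrimeSpectrum A)} (h : V ≤ U) : sectionsC U →+* sectionsC V where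
  toFun s := ⟨fun p => s.1 ⟨p.1, h p.2⟩, fun p => by
    obtain ⟨W, hpW, hWU, a, f, k⟩ := s.2 ⟨p.1, h p.2⟩
    exact ⟨W ⊓ V, ⟨hpW, p.2⟩, inf_le_right, a, f, fun q hq => k q hq.1⟩⟩
  map_zero' := rfl
  map_one' := rfl
  map_add' _ _ := rfl
  map_mul' _ _ := rfl

variable (A) in
/-- The presheaf of functions that are locally quotients. -/
def sheafC : TopCat.Presheaf CommSemiRingCat.{u} (specTop A) where
  obj U := CommSemiRingCat.of (sectionsC (A := A) U.unop)
  map f := CommSemiRingCat.ofHom (sectionsCRes f.unop.le)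
  map_id _ := rfl
  map_comp _ _ := rfl

/-- The map `S_U⁻¹ A → A_𝔭`, `a / s ↦ a / s`, for `𝔭 ∈ U`. -/
def locToAtPrime {U : Opens (PrimeSpectrum A)} (p : U) :
    Loc U →+* Localization.AtPrime p.1.asIdeal :=
  IsLocalization.map (M := nonvanishing U) (T := p.1.asIdeal.primeCompl)
    (Localization.AtPrime p.1.asIdeal) (RingHom.id A) (nonvanishing_le_primeCompl p.2)

theorem locToAtPrime_algebraMap {U : Opens (PrimeSpectrum A)} (p : U) (x : A) :
    locToAtPrime p (algebraMap A (Loc U) x) = algebraMap A (Localization.AtPrime p.1.asIdeal) x :=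
  IsLocalization.map_eq (T := p.1.asIdeal.primeCompl) (Q := Localization.AtPrime p.1.asIdeal)
    (g := RingHom.id A) (nonvanishing_le_primeCompl p.2) x

/-- `S_U⁻¹ A → O(U)`, sending `a / f` to the function `𝔭 ↦ a / f`. -/
def locToSectionsC (U : Opens (PrimeSpectrum A)) : Loc U →+* sectionsC U where
  toFun x := ⟨fun p => locToAtPrime p x, fun p => by
    obtain ⟨a, s, rfl⟩ := IsLocalization.exists_mk'_eq (nonvanishing U) x
    exact ⟨U, p.2, le_rfl, a, s.1, fun q hq => ⟨nonvanishing_le_primeCompl hq s.2, 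
      IsLocalization.map_mk' (T := q.asIdeal.primeCompl) (Q := Localization.AtPrime q.asIdeal)
        (g := RingHom.id A) (nonvanishing_le_primeCompl hq) a s⟩⟩⟩
  map_zero' := by ext; simp
  map_one' := by ext; simp
  map_add' _ _ := by ext; simp
  map_mul' _ _ := by ext; simp

variable (A) in
/-- The canonical morphism from the presheaf of localizations to the sheaf of functions that are
locally quotients. -/
def toSheafC : locPresheaf A ⟶ sheafC A where
  app U := CommSemiRingCat.ofHom (locToSectionsC (A := A) U.unop)
  naturality U V f := by
    ext x
    refine Subtype.ext (funext fun p => ?_)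
    have h : (locToAtPrime p).comp (locRes f.unop.le) =
        locToAtPrime (A := A) (U := U.unop) ⟨p.1, f.unop.le p.2⟩ := by
      apply IsLocalization.ringHom_ext (nonvanishing (A := A) U.unop)
      ext y
      simp [locRes_algebraMap, locToAtPrime_algebraMap]
    exact RingHom.congr_fun h x

/-! ## Sections on principal open sets, global sections and stalks -/

theorem powers_le_nonvanishing (a : A) :
    Submonoid.powers a ≤ nonvanishing (PrimeSpectrum.basicOpen a) :=
  Submonoid.powers_le.2 (le_refl (PrimeSpectrum.basicOpen a))

/-- The natural map `A_a = A[a⁻¹] → S_a⁻¹ A`, `x / aⁿ ↦ x / aⁿ`. -/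
def awayToLoc (a : A) : Localization.Away a →+* Loc (PrimeSpectrum.basicOpen a) :=
  IsLocalization.map (M := Submonoid.powers a) (T := nonvanishing (PrimeSpectrum.basicOpen a))
    (Loc (PrimeSpectrum.basicOpen a)) (RingHom.id A) (powers_le_nonvanishing a)

/-- Let `η` be a morphism from the presheaf of localizations to a presheaf `O`. The sections of `O`
over `D(a)`, the global sections of `O` and the stalks of `O` are the localizations `A_a`, the
semiring `A` and the local semirings `A_𝔭`, through the maps induced by `η`. -/
structure IsLocalizationPresheaf (O : TopCat.Presheaf CommSemiRingCat.{u} (specTop A))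
    (η : locPresheaf A ⟶ O) : Prop where
  /-- The natural map `A_a → S_a⁻¹ A → O(D(a))` is an isomorphism. -/
  isIso_away (a : A) :
    IsIso (CommSemiRingCat.ofHom (awayToLoc a) ≫ η.app (op (PrimeSpectrum.basicOpen a)))
  /-- The natural map `A → S_X⁻¹ A → O(X)` is an isomorphism. -/
  isIso_global :
    IsIso (CommSemiRingCat.ofHom (algebraMap A (Loc (⊤ : Opens (PrimeSpectrum A)))) ≫
      η.app (op ⊤))
  /-- The stalk at `𝔭` is isomorphic to `A_𝔭`, compatibly with the natural maps from `A`. -/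
  stalk_iso (p : PrimeSpectrum A) :
    ∃ e : CommSemiRingCat.of (Localization.AtPrime p.asIdeal) ≅ stalk O p,
      CommSemiRingCat.ofHom (algebraMap A (Localization.AtPrime p.asIdeal)) ≫ e.hom =
        CommSemiRingCat.ofHom (algebraMap A (Loc (⊤ : Opens (PrimeSpectrum A)))) ≫
          η.app (op ⊤) ≫ germTop O p
  /-- The stalks are local semirings. -/
  isLocalRing_stalk (p : PrimeSpectrum A) : IsLocalRing (stalk O p)

end

end SemiringSpec

namespace SemiringSpec

noncomputable section

variable {A : Type u} [CommSemiring A]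

/-! ## Sections of the third construction over principal open sets -/

/-! Everything rests on one computation: `S_a⁻¹ A → O^C(D(a))` is bijective. Two facts that need no
subtraction drive it: the radical of an ideal is the intersection of the primes above it, and `{c |
c * u = c * v}` is an ideal, which replaces the annihilator of `u - v`. An ideal contained in no `𝔭
∈ D(a)` therefore contains a power of `a`. Injectivity applies this to the ideal above
(`exists_pow_mul_eq`); surjectivity is a partition of unity argument (`locToSectionsC_surjective`).

Construction (C) is a sheaf because its defining condition is local. Gluing its sections along
principal open sets identifies it with (B) for any principal covering. Hence `η^B` and `η^C` are
isomorphisms on every `D(a)`. Such a morphism is universal among morphisms from the presheaf of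
localizations to sheaves (`existsUnique_hom_of_isIso_basicOpen`), as is the map to the
sheafification, so (A) agrees with the other two.

The assertions on sections and stalks then follow, for any `η` that is an isomorphism on all `D(a)`,
from `A_a ≅ S_a⁻¹ A`, from `X = D(1)`, and from the cofinality of principal open sets among the
neighbourhoods of a point. -/

theorem exists_pow_mem_of_forall_not_le (I : Ideal A) (a : A)
    (h : ∀ p ∈ PrimeSpectrum.basicOpen a, ¬ I ≤ p.asIdeal) : ∃ n : ℕ, a ^ n ∈ I := by
  have key : a ∈ I.radical := by
    rw [Ideal.radical_eq_sInf, Ideal.mem_sInf]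
    rintro J ⟨hIJ, hJ⟩
    by_contra ha
    exact h ⟨J, hJ⟩ ha hIJ
  exact key

theorem pow_mem_nonvanishing (a : A) (n : ℕ) :
    a ^ n ∈ nonvanishing (PrimeSpectrum.basicOpen a) :=
  pow_mem (le_refl (PrimeSpectrum.basicOpen a)) n

theorem locToAtPrime_mk' {U : Opens (PrimeSpectrum A)} (p : U) (x : A) (s : nonvanishing U) :
    locToAtPrime p (IsLocalization.mk' (Loc U) x s) =
      IsLocalization.mk' (Localization.AtPrime p.1.asIdeal) x
        (⟨s.1, nonvanishing_le_primeCompl p.2 s.2⟩ : p.1.asIdeal.primeCompl) :=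
  IsLocalization.map_mk' (T := p.1.asIdeal.primeCompl) (Q := Localization.AtPrime p.1.asIdeal)
    (g := RingHom.id A) (nonvanishing_le_primeCompl p.2) x s

theorem locToAtPrime_locRes {U V : Opens (PrimeSpectrum A)} (h : V ≤ U) (p : V) (x : Loc U) :
    locToAtPrime p (locRes h x) = locToAtPrime ⟨p.1, h p.2⟩ x := by
  have key : (locToAtPrime p).comp (locRes h) = locToAtPrime (U := U) ⟨p.1, h p.2⟩ := by
    apply IsLocalization.ringHom_ext (nonvanishing U)
    ext y
    simp [locRes_algebraMap, locToAtPrime_algebraMap]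
  exact RingHom.congr_fun key x

/-- If two fractions with denominators nonvanishing on `D(a)` agree in all the `A_𝔭` with
`𝔭 ∈ D(a)`, then they agree after multiplication by a power of `a`. -/
theorem exists_pow_mul_eq {a x y s t : A}
    (h : ∀ (p : PrimeSpectrum A), a ∉ p.asIdeal → ∃ c ∉ p.asIdeal, c * (t * x) = c * (s * y)) :
    ∃ n : ℕ, a ^ n * (t * x) = a ^ n * (s * y) := by
  let I : Ideal A :=
    { carrier := {c | c * (t * x) = c * (s * y)}
      zero_mem' := by simp
      add_mem' := fun {b c} hb hc => by
        simp only [Set.mem_ofPred_eq] at hb hc ⊢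
        rw [add_mul, add_mul, hb, hc]
      smul_mem' := fun b c hc => by
        simp only [Set.mem_ofPred_eq, smul_eq_mul] at hc ⊢
        rw [mul_assoc, mul_assoc, hc] }
  refine exists_pow_mem_of_forall_not_le I a fun p hp hI => ?_
  obtain ⟨c, hc, e⟩ := h p hp
  exact hc (hI e)

theorem eq_of_locToAtPrime_eq {a : A} {x y : Loc (PrimeSpectrum.basicOpen a)}
    (h : ∀ p, locToAtPrime p x = locToAtPrime p y) : x = y := by
  obtain ⟨x, s, rfl⟩ := IsLocalization.exists_mk'_eq (nonvanishing (PrimeSpectrum.basicOpen a)) x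
  obtain ⟨y, t, rfl⟩ := IsLocalization.exists_mk'_eq (nonvanishing (PrimeSpectrum.basicOpen a)) y
  obtain ⟨n, hn⟩ := exists_pow_mul_eq (a := a) (x := x) (y := y) (s := s.1) (t := t.1)
    fun p hp => by
      have e := h ⟨p, hp⟩
      rw [locToAtPrime_mk', locToAtPrime_mk', IsLocalization.eq] at e
      obtain ⟨c, hc⟩ := e
      exact ⟨c.1, c.2, hc⟩
  exact IsLocalization.eq.2 ⟨⟨a ^ n, pow_mem_nonvanishing a n⟩, hn⟩

theorem locToSectionsC_injective (a : A) :
    Function.Injective (locToSectionsC (PrimeSpectrum.basicOpen a)) := fun _ _ h =>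
  eq_of_locToAtPrime_eq fun p => congr_fun (congr_arg Subtype.val h) p

theorem exists_basicOpen_le {U : Opens (PrimeSpectrum A)} {p : PrimeSpectrum A} (hp : p ∈ U) :
    ∃ a : A, p ∈ PrimeSpectrum.basicOpen a ∧ PrimeSpectrum.basicOpen a ≤ U := by
  obtain ⟨_, ⟨g, rfl⟩, hpg, hgU⟩ :=
    Opens.isBasis_iff_nbhd.1 PrimeSpectrum.isBasis_basic_opens hp
  exact ⟨g, hpg, hgU⟩

/-- The section `t` is the fraction `x / f` on `D(f)`. -/
def IsFractionOn {U : Opens (PrimeSpectrum A)} (t : sectionsC U) (x f : A) : Prop :=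
  ∃ hle : PrimeSpectrum.basicOpen f ≤ U, ∀ (q : PrimeSpectrum A) (hf : f ∉ q.asIdeal),
    t.1 ⟨q, hle hf⟩ = IsLocalization.mk' (Localization.AtPrime q.asIdeal) x
      (⟨f, hf⟩ : q.asIdeal.primeCompl)

/-- Expanding `x / f` by some `g` with `p ∈ D(g) ⊆ V` shrinks the locus of the denominator: `D(f *
g)` lies in the set `V` where the fraction is valid. -/
theorem exists_isFractionOn {U : Opens (PrimeSpectrum A)} (t : sectionsC U)
    (p : PrimeSpectrum A) (hp : p ∈ U) : ∃ x f, f ∉ p.asIdeal ∧ IsFractionOn t x f := by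
  obtain ⟨V, hpV, hVU, x, f, h⟩ := t.2 ⟨p, hp⟩
  obtain ⟨g, hpg, hgV⟩ := exists_basicOpen_le hpV
  obtain ⟨hfp, -⟩ := h p hpV
  refine ⟨x * g, f * g, p.asIdeal.primeCompl.mul_mem hfp hpg,
    ((PrimeSpectrum.basicOpen_mul_le_right f g).trans hgV).trans hVU, fun q hq => ?_⟩
  have hgq : g ∉ q.asIdeal := fun hg => hq (q.asIdeal.mul_mem_left f hg)
  obtain ⟨hfq, e⟩ := h q (hgV hgq)
  rw [e]
  exact IsLocalization.eq.2 ⟨1, by simp only [OneMemClass.coe_one]; ring⟩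

theorem IsFractionOn.exists_pow_mul_eq {U : Opens (PrimeSpectrum A)} {t : sectionsC U}
    {x f y g : A} (h : IsFractionOn t x f) (k : IsFractionOn t y g) :
    ∃ n : ℕ, (f * g) ^ n * (g * x) = (f * g) ^ n * (f * y) := by
  refine SemiringSpec.exists_pow_mul_eq fun p hp => ?_
  have hf : f ∉ p.asIdeal := fun hf => hp (p.asIdeal.mul_mem_right g hf)
  have hg : g ∉ p.asIdeal := fun hg => hp (p.asIdeal.mul_mem_left f hg)
  obtain ⟨c, hc⟩ := IsLocalization.eq.1 ((h.2 p hf).symm.trans (k.2 p hg))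
  exact ⟨c.1, c.2, hc⟩

/-- Finitely many of the local fractions `x_i / f_i` suffice. Once they are expanded so that the
cross products agree exactly, a relation `a ^ m = ∑ b_i * f_i ^ (N + 1)` combines them into a single
fraction with denominator `a ^ m`. -/
theorem locToSectionsC_surjective (a : A) :
    Function.Surjective (locToSectionsC (PrimeSpectrum.basicOpen a)) := by
  intro t
  let σ := {r : A × A // IsFractionOn t r.1 r.2}
  -- All denominators together generate an ideal containing a power of `a`; the support of the
  -- resulting combination `c` is the finite subcover.
  obtain ⟨n, hn⟩ := exists_pow_mem_of_forall_not_le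
    (Ideal.span (Set.range fun r : σ => r.1.2)) a fun p hp hI => by
      obtain ⟨x, f, hf, hxf⟩ := exists_isFractionOn t p hp
      exact hf (hI (Ideal.subset_span ⟨⟨(x, f), hxf⟩, rfl⟩))
  obtain ⟨c, hc⟩ := Finsupp.mem_ideal_span_range_iff_exists_finsupp.1 hn
  have hex : ∀ i j : σ, ∃ n : ℕ, (i.1.2 * j.1.2) ^ n * (j.1.2 * i.1.1) =
      (i.1.2 * j.1.2) ^ n * (i.1.2 * j.1.1) := fun i j => i.2.exists_pow_mul_eq j.2
  choose k hk using hex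
  obtain ⟨N, hN⟩ : ∃ N : ℕ, ∀ i ∈ c.support, ∀ j ∈ c.support, k i j ≤ N :=
    ⟨c.support.sup fun i => c.support.sup (k i), fun i hi j hj =>
      (Finset.le_sup hj).trans (Finset.le_sup (f := fun i => c.support.sup (k i)) hi)⟩
  -- With `N` bounding all the exponents, the fractions `x_i * f_i ^ N / f_i ^ (N + 1)` satisfy the
  -- cross-multiplied identity without any auxiliary factor.
  have hcomm : ∀ i ∈ c.support, ∀ j ∈ c.support,
      j.1.2 ^ (N + 1) * (i.1.1 * i.1.2 ^ N) = i.1.2 ^ (N + 1) * (j.1.1 * j.1.2 ^ N) := by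
    intro i hi j hj
    obtain ⟨d, hd⟩ := Nat.exists_eq_add_of_le (hN i hi j hj)
    have e := congr_arg ((i.1.2 * j.1.2) ^ d * ·) (hk i j)
    simp only [← mul_assoc, ← pow_add] at e
    rw [add_comm d, ← hd] at e
    calc _ = (i.1.2 * j.1.2) ^ N * j.1.2 * i.1.1 := by ring
      _ = _ := e
      _ = _ := by ring
  -- The powers `f_i ^ (N + 1)` still cover `D(a)`: a prime containing all of them contains every
  -- `f_i` of the support, hence `a ^ n`.
  obtain ⟨m, hm⟩ := exists_pow_mem_of_forall_not_le
    (Ideal.span ((fun r : σ => r.1.2 ^ (N + 1)) '' c.support)) a fun p hp hI => by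
      refine hp (p.isPrime.mem_of_pow_mem n ?_)
      rw [← hc]
      exact Ideal.sum_mem _ fun i hi => p.asIdeal.mul_mem_left _
        (p.isPrime.mem_of_pow_mem (N + 1) (hI (Ideal.subset_span ⟨i, hi, rfl⟩)))
  obtain ⟨b, hb⟩ := (Submodule.mem_span_image_finset_iff_exists_fun A).1 hm
  simp only [smul_eq_mul] at hb
  refine ⟨IsLocalization.mk' _ (∑ i : c.support, b i * (i.1.1.1 * i.1.1.2 ^ N))
    (⟨a ^ m, pow_mem_nonvanishing a m⟩ : nonvanishing (PrimeSpectrum.basicOpen a)), ?_⟩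
  refine Subtype.ext (funext fun q => ?_)
  obtain ⟨j, hj, hjq⟩ : ∃ j ∈ c.support, j.1.2 ∉ q.1.asIdeal := by
    by_contra! H
    refine q.2 (q.1.isPrime.mem_of_pow_mem n ?_)
    rw [← hc]
    exact Ideal.sum_mem _ fun i hi => q.1.asIdeal.mul_mem_left _ (H i hi)
  refine (locToAtPrime_mk' q _ _).trans (Eq.trans ?_ (j.2.2 q.1 hjq).symm)
  -- The factor `f_j ^ N` supplies the power that `hcomm` requires; it is invertible at `q`.
  refine IsLocalization.eq.2 ⟨⟨j.1.2 ^ N, pow_mem (S := q.1.asIdeal.primeCompl) hjq N⟩, ?_⟩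
  simp only
  calc j.1.2 ^ N * (j.1.2 * ∑ i : c.support, b i * (i.1.1.1 * i.1.1.2 ^ N))
      = ∑ i : c.support, b i * (j.1.2 ^ (N + 1) * (i.1.1.1 * i.1.1.2 ^ N)) := by
        rw [← mul_assoc, ← pow_succ, Finset.mul_sum]
        exact Finset.sum_congr rfl fun i _ => by ring
    _ = ∑ i : c.support, b i * i.1.1.2 ^ (N + 1) * (j.1.1 * j.1.2 ^ N) :=
        Finset.sum_congr rfl fun i _ => by rw [hcomm i.1 i.2 j hj, mul_assoc]
    _ = j.1.2 ^ N * (a ^ m * j.1.1) := by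
        rw [← Finset.sum_mul, hb]
        ring

variable (A) in
/-- The sections over `D(a)` of the sheaf of functions that are locally quotients are the
elements of `S_a⁻¹ A`. -/
def locEquivSectionsC (a : A) :
    Loc (PrimeSpectrum.basicOpen a) ≃+* sectionsC (PrimeSpectrum.basicOpen a) :=
  RingEquiv.ofBijective (locToSectionsC (PrimeSpectrum.basicOpen a))
    ⟨locToSectionsC_injective a, locToSectionsC_surjective a⟩

/-! ## Gluing for the third construction -/

/-- Compatibility is stated pointwise so that both the sheaf condition and the equalizers over
`D(a_i * a_j)` can feed into it. -/
theorem existsUnique_gluing_sectionsC {ι : Type*} {U : Opens (PrimeSpectrum A)}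
    (V : ι → Opens (PrimeSpectrum A)) (hVU : ∀ i, V i ≤ U) (hUV : U ≤ ⨆ i, V i)
    (s : ∀ i, sectionsC (V i))
    (hs : ∀ i j p (hi : p ∈ V i) (hj : p ∈ V j), (s i).1 ⟨p, hi⟩ = (s j).1 ⟨p, hj⟩) :
    ∃! t : sectionsC U, ∀ i, sectionsCRes (hVU i) t = s i := by
  have hex : ∀ p : U, ∃ i, p.1 ∈ V i := fun p => Opens.mem_iSup.1 (hUV p.2)
  choose k hk using hex
  refine ⟨⟨fun p => (s (k p)).1 ⟨p.1, hk p⟩, fun p => ?_⟩, fun i => ?_, fun t ht => ?_⟩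
  · obtain ⟨W, hpW, hWV, x, f, h⟩ := (s (k p)).2 ⟨p.1, hk p⟩
    refine ⟨W, hpW, hWV.trans (hVU _), x, f, fun q hq => ?_⟩
    obtain ⟨hf, e⟩ := h q hq
    exact ⟨hf, (hs _ (k p) q (hk ⟨q, hVU _ (hWV hq)⟩) (hWV hq)).trans e⟩
  · exact Subtype.ext (funext fun p => hs _ _ p.1 _ _)
  · refine Subtype.ext (funext fun p => ?_)
    exact congr_fun (congr_arg Subtype.val (ht (k p))) ⟨p.1, hk p⟩

variable (A) in
theorem isSheaf_sheafC : (sheafC A).IsSheaf := by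
  refine (TopCat.Presheaf.isSheaf_iff_isSheafUniqueGluing _).2 fun ι U sf hsf => ?_
  exact existsUnique_gluing_sectionsC (A := A) U (fun i => (Opens.leSupr U i).le) le_rfl sf
    fun i j p hi hj => congr_fun (congr_arg Subtype.val (hsf i j)) ⟨p, hi, hj⟩

/-! ## Comparison of the second and third constructions -/

theorem locRes_locEquivSectionsC_symm {a b : A}
    (h : PrimeSpectrum.basicOpen b ≤ PrimeSpectrum.basicOpen a)
    (s : sectionsC (PrimeSpectrum.basicOpen a)) :
    locRes h ((locEquivSectionsC A a).symm s) =
      (locEquivSectionsC A b).symm (sectionsCRes h s) := by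
  obtain ⟨x, rfl⟩ := (locEquivSectionsC A a).surjective s
  rw [RingEquiv.symm_apply_apply, RingEquiv.eq_symm_apply]
  exact Subtype.ext (funext fun p => locToAtPrime_locRes h p x)

/-- For principal open sets `D(a i) ⊆ U`, the map sending a section over `U` to the family of
its restrictions to the `D(a i)`. -/
def sectionsCToEqualizer (U : Opens (PrimeSpectrum A)) {ι : Type v} (a : ι → A)
    (h : ∀ i, PrimeSpectrum.basicOpen (a i) ≤ U) : sectionsC U →+* principalEqualizer a where
  toFun s := ⟨fun i => (locEquivSectionsC A (a i)).symm (sectionsCRes (h i) s), fun i j => by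
    rw [locRes_locEquivSectionsC_symm, locRes_locEquivSectionsC_symm]
    rfl⟩
  map_zero' := by ext; simp
  map_one' := by ext; simp
  map_add' _ _ := by ext; simp
  map_mul' _ _ := by ext; simp

/-- Through `locEquivSectionsC`, a family in the equalizer is a family of functions on the `D(a_i)`.
They agree on `D(a_i * a_j) = D(a_i) ∩ D(a_j)`, so they glue uniquely. -/
theorem sectionsCToEqualizer_bijective (U : Opens (PrimeSpectrum A)) {ι : Type v} (a : ι → A)
    (h : ∀ i, PrimeSpectrum.basicOpen (a i) ≤ U) (hU : U ≤ ⨆ i, PrimeSpectrum.basicOpen (a i)) :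
    Function.Bijective (sectionsCToEqualizer U a h) := by
  rw [Function.bijective_iff_existsUnique]
  intro s
  have key := existsUnique_gluing_sectionsC (fun i => PrimeSpectrum.basicOpen (a i)) h hU
    (fun i => locEquivSectionsC A (a i) (s.1 i)) fun i j p hi hj => by
      have hp : p ∈ PrimeSpectrum.basicOpen (a i * a j) := by
        rw [PrimeSpectrum.basicOpen_mul]
        exact ⟨hi, hj⟩
      have e := congr_arg (locToAtPrime ⟨p, hp⟩) (s.2 i j)
      rwa [locToAtPrime_locRes, locToAtPrime_locRes] at e
  refine (existsUnique_congr fun t => ?_).1 key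
  rw [Subtype.ext_iff, funext_iff]
  exact forall_congr' fun i => ((locEquivSectionsC A (a i)).symm_apply_eq).symm

theorem le_iSup_basicOpen (U : Opens (PrimeSpectrum A)) :
    U ≤ ⨆ a : {a : A // PrimeSpectrum.basicOpen a ≤ U}, PrimeSpectrum.basicOpen a.1 := by
  intro p hp
  obtain ⟨g, hpg, hgU⟩ := exists_basicOpen_le hp
  exact Opens.mem_iSup.2 ⟨⟨g, hgU⟩, hpg⟩

/-- The comparison of the sections over `U` of the second and third constructions. -/
def sectionsCEquivSectionsB (U : Opens (PrimeSpectrum A)) : sectionsC U ≃+* SectionsB U :=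
  RingEquiv.ofBijective (sectionsCToEqualizer U _ fun a => a.2)
    (sectionsCToEqualizer_bijective U _ _ (le_iSup_basicOpen U))

/-- Precomposing the projection with `O^C(U) ≅ O^B(U)` gives `sectionsCToEqualizer`, already
bijective, so the isomorphism can be cancelled. -/
theorem sectionsBToEqualizer_bijective (U : Opens (PrimeSpectrum A)) {ι : Type v} (a : ι → A)
    (h : ∀ i, PrimeSpectrum.basicOpen (a i) ≤ U) (hU : U ≤ ⨆ i, PrimeSpectrum.basicOpen (a i)) :
    Function.Bijective (sectionsBToEqualizer U a h) :=
  (Function.Bijective.of_comp_iff (sectionsBToEqualizer U a h)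
    (sectionsCEquivSectionsB U).bijective).1 (sectionsCToEqualizer_bijective U a h hU)

variable (A) in
/-- The isomorphism between the third and the second construction. -/
def sheafCIsoSheafB : sheafC A ≅ sheafB A :=
  NatIso.ofComponents
    (fun U => RingEquiv.toCommSemiRingCatIso (sectionsCEquivSectionsB (A := A) U.unop))
    fun _ => rfl

theorem toSheafC_comp_sheafCIsoSheafB_hom :
    toSheafC A ≫ (sheafCIsoSheafB A).hom = toSheafB A := by
  ext U x
  refine Subtype.ext (funext fun a => ?_)
  refine (RingEquiv.symm_apply_eq _).2 (Subtype.ext (funext fun p => ?_))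
  exact (locToAtPrime_locRes (A := A) a.2 p x).symm

variable (A) in
theorem isSheaf_sheafB : (sheafB A).IsSheaf :=
  TopCat.Presheaf.isSheaf_of_iso (sheafCIsoSheafB A) (isSheaf_sheafC A)

instance isIso_toSheafC_app (a : A) :
    IsIso ((toSheafC A).app (op (PrimeSpectrum.basicOpen a))) :=
  inferInstanceAs (IsIso (RingEquiv.toCommSemiRingCatIso (locEquivSectionsC A a)).hom)

instance isIso_toSheafB_app (a : A) :
    IsIso ((toSheafB A).app (op (PrimeSpectrum.basicOpen a))) := by
  rw [← toSheafC_comp_sheafCIsoSheafB_hom, NatTrans.comp_app]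
  infer_instance

/-! ## The universal property of the sheaf associated with the presheaf of localizations -/

/-- On each `D(a)` the morphism must be `η⁻¹ ≫ η'`. These maps are natural on a basis, and morphisms
into a sheaf are determined by, and extend from, a basis. -/
theorem existsUnique_hom_of_isIso_basicOpen {O O' : TopCat.Presheaf CommSemiRingCat.{u} (specTop A)}
    (η : locPresheaf A ⟶ O) (hη : ∀ a : A, IsIso (η.app (op (PrimeSpectrum.basicOpen a))))
    (hO' : O'.IsSheaf) (η' : locPresheaf A ⟶ O') : ∃! φ : O ⟶ O', η ≫ φ = η' := by
  let B : A → Opens (specTop A) := PrimeSpectrum.basicOpen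
  have hB : Opens.IsBasis (Set.range B) := PrimeSpectrum.isBasis_basic_opens
  let F' : TopCat.Sheaf CommSemiRingCat.{u} (specTop A) := ⟨O', hO'⟩
  have hη' : ∀ a, IsIso (η.app (op (B a))) := hη
  let α : (inducedFunctor B).op ⋙ O ⟶ (inducedFunctor B).op ⋙ F'.1 :=
    { app := fun a => inv (η.app (op (B a.unop))) ≫ η'.app (op (B a.unop))
      naturality := fun a b f => by
        have h := η.naturality ((inducedFunctor B).op.map f)
        have h' := η'.naturality ((inducedFunctor B).op.map f)
        rw [← cancel_epi (η.app (op (B a.unop))), Category.assoc, IsIso.hom_inv_id_assoc]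
        refine Eq.trans ?_ h'
        exact ((reassoc_of% h) _).symm.trans (congr_arg _
          (IsIso.hom_inv_id_assoc (η.app (op (B b.unop))) _)) }
  refine ⟨TopCat.Sheaf.restrictHomEquivHom O F' hB α, ?_, fun φ hφ => ?_⟩
  · refine TopCat.Sheaf.hom_ext (locPresheaf A) F' hB fun a => ?_
    rw [NatTrans.comp_app]
    erw [TopCat.Sheaf.extend_hom_app]
    exact IsIso.hom_inv_id_assoc _ _
  · refine TopCat.Sheaf.hom_ext O F' hB fun a => ?_
    erw [TopCat.Sheaf.extend_hom_app]
    rw [IsIso.eq_inv_comp, ← hφ, NatTrans.comp_app]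

theorem exists_iso_of_existsUnique_hom {C : Type*} [Category C] {F O O' : C} (η : F ⟶ O)
    (η' : F ⟶ O') (h₁ : ∃! φ : O ⟶ O, η ≫ φ = η) (h₂ : ∃! φ : O ⟶ O', η ≫ φ = η')
    (h₃ : ∃! φ : O' ⟶ O, η' ≫ φ = η) (h₄ : ∃! φ : O' ⟶ O', η' ≫ φ = η') :
    ∃ e : O ≅ O', η ≫ e.hom = η' := by
  obtain ⟨f, hf, -⟩ := h₂
  obtain ⟨g, hg, -⟩ := h₃
  exact ⟨⟨f, g, h₁.unique (by simp only [reassoc_of% hf, hg]) (Category.comp_id _),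
    h₄.unique (by simp only [reassoc_of% hg, hf]) (Category.comp_id _)⟩, hf⟩

variable (A) in
theorem isSheaf_sheafA : (sheafA A).IsSheaf :=
  ((presheafToSheaf (Opens.grothendieckTopology (specTop A)) CommSemiRingCat.{u}).obj
    (locPresheaf A)).property

theorem existsUnique_hom_sheafA {O' : TopCat.Presheaf CommSemiRingCat.{u} (specTop A)}
    (hO' : O'.IsSheaf) (η' : locPresheaf A ⟶ O') : ∃! φ : sheafA A ⟶ O', toSheafA A ≫ φ = η' :=
  ⟨sheafifyLift _ η' hO', toSheafify_sheafifyLift _ _ _, fun _ h =>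
    sheafifyLift_unique _ _ _ _ h⟩

theorem exists_iso_sheafA {O : TopCat.Presheaf CommSemiRingCat.{u} (specTop A)}
    (hO : O.IsSheaf) (η : locPresheaf A ⟶ O)
    (hη : ∀ a : A, IsIso (η.app (op (PrimeSpectrum.basicOpen a)))) :
    ∃ e : sheafA A ≅ O, toSheafA A ≫ e.hom = η :=
  exists_iso_of_existsUnique_hom _ _ (existsUnique_hom_sheafA (isSheaf_sheafA A) _)
    (existsUnique_hom_sheafA hO _) (existsUnique_hom_of_isIso_basicOpen η hη (isSheaf_sheafA A) _)
    (existsUnique_hom_of_isIso_basicOpen η hη hO _)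

instance isIso_toSheafA_app (a : A) :
    IsIso ((toSheafA A).app (op (PrimeSpectrum.basicOpen a))) := by
  -- The sheafification is never computed explicitly: the property is transported from (C).
  obtain ⟨e, he⟩ := exists_iso_sheafA (isSheaf_sheafC A) (toSheafC A) inferInstance
  rw [← Iso.eq_comp_inv] at he
  rw [he, NatTrans.comp_app]
  infer_instance

/-! ## Sections and stalks -/

/-- `D(a) ⊆ D(b)` means that `b` divides a power of `a`, so every element of `S_a` is already
invertible in `A_a`. -/
theorem awayToLoc_bijective (a : A) : Function.Bijective (awayToLoc a) := by
  have : IsLocalization (nonvanishing (PrimeSpectrum.basicOpen a)) (Localization.Away a) := by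
    refine IsLocalization.of_le_of_exists_dvd (Submonoid.powers a) _ (powers_le_nonvanishing a)
      fun b hb => ?_
    obtain ⟨n, hn⟩ := (PrimeSpectrum.basicOpen_le_basicOpen_iff a b).1 hb
    exact ⟨a ^ n, ⟨n, rfl⟩, Ideal.mem_span_singleton.1 hn⟩
  have e : awayToLoc a = (IsLocalization.algEquiv (nonvanishing (PrimeSpectrum.basicOpen a))
      (Localization.Away a) (Loc (PrimeSpectrum.basicOpen a)) : _ →+* _) := by
    apply IsLocalization.ringHom_ext (Submonoid.powers a)
    ext x
    refine (IsLocalization.map_eq (T := nonvanishing (PrimeSpectrum.basicOpen a))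
      (powers_le_nonvanishing a) x).trans ?_
    simp
  rw [e]
  exact (IsLocalization.algEquiv (nonvanishing (PrimeSpectrum.basicOpen a))
      (Localization.Away a) (Loc (PrimeSpectrum.basicOpen a))).bijective

variable (A) in
-- `S_X` consists of units, since a nonunit lies in some maximal ideal.
theorem algebraMap_loc_top_bijective :
    Function.Bijective (algebraMap A (Loc (⊤ : Opens (PrimeSpectrum A)))) := by
  refine (IsLocalization.atUnits A (nonvanishing ⊤) fun b hb => ?_).bijective
  by_contra h
  obtain ⟨m, hm, hbm⟩ := exists_max_ideal_of_mem_nonunits h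
  exact hb (show (⟨m, hm.isPrime⟩ : PrimeSpectrum A) ∈ (⊤ : Opens (PrimeSpectrum A)) from trivial)
    hbm

theorem isIso_of_bijective {R S : CommSemiRingCat.{u}} (f : R ⟶ S) (hf : Function.Bijective f) :
    IsIso f :=
  inferInstanceAs (IsIso (RingEquiv.toCommSemiRingCatIso (RingEquiv.ofBijective f.hom hf)).hom)

section Stalk

variable {O : TopCat.Presheaf CommSemiRingCat.{u} (specTop A)} (η : locPresheaf A ⟶ O)

/-- The germ at `x` of a section over an open neighbourhood of `x`. -/
def germ {X : TopCat.{u}} (G : TopCat.Presheaf CommSemiRingCat.{u} X) (x : X) (U : Opens X)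
    (hx : x ∈ U) : G.obj (op U) ⟶ stalk G x :=
  Limits.colimit.ι ((OpenNhds.inclusion x).op ⋙ G) (op ⟨U, hx⟩)

theorem germ_res {X : TopCat.{u}} (G : TopCat.Presheaf CommSemiRingCat.{u} X) (x : X)
    {U V : Opens X} (h : V ≤ U) (hx : x ∈ V) (s : G.obj (op U)) :
    germ G x V hx (G.map (homOfLE h).op s) = germ G x U (h hx) s :=
  ConcreteCategory.congr_hom (Limits.colimit.w ((OpenNhds.inclusion x).op ⋙ G)
    (homOfLE h : (⟨V, hx⟩ : OpenNhds x) ⟶ ⟨U, h hx⟩).op) s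

theorem exists_germ_eq {X : TopCat.{u}} (G : TopCat.Presheaf CommSemiRingCat.{u} X) (x : X)
    (t : stalk G x) : ∃ (U : Opens X) (hx : x ∈ U) (s : G.obj (op U)), germ G x U hx s = t := by
  obtain ⟨U, s, h⟩ := Limits.Concrete.colimit_exists_rep ((OpenNhds.inclusion x).op ⋙ G) t
  exact ⟨U.unop.1, U.unop.2, s, h⟩

theorem exists_res_eq_of_germ_eq {X : TopCat.{u}} (G : TopCat.Presheaf CommSemiRingCat.{u} X)
    (x : X) {U V : Opens X} (hU : x ∈ U) (hV : x ∈ V) (s : G.obj (op U)) (t : G.obj (op V))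
    (h : germ G x U hU s = germ G x V hV t) : ∃ (W : Opens X) (_ : x ∈ W) (k : W ≤ U) (l : W ≤ V),
      G.map (homOfLE k).op s = G.map (homOfLE l).op t := by
  obtain ⟨W, f, g, e⟩ := Limits.Concrete.colimit_exists_of_rep_eq.{u}
    ((OpenNhds.inclusion x).op ⋙ G) (i := op ⟨U, hU⟩) (j := op ⟨V, hV⟩) s t h
  exact ⟨W.unop.1, W.unop.2, leOfHom ((OpenNhds.inclusion x).map f.unop),
    leOfHom ((OpenNhds.inclusion x).map g.unop), e⟩

/-- The natural map from `A` to the stalk at `p`. -/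
def toStalk (p : PrimeSpectrum A) : A →+* stalk O p :=
  (CommSemiRingCat.ofHom (algebraMap A (Loc (⊤ : Opens (PrimeSpectrum A)))) ≫
    η.app (op ⊤) ≫ germTop O p).hom

theorem map_app_algebraMap {U V : Opens (PrimeSpectrum A)} (h : V ≤ U) (x : A) :
    O.map (homOfLE h).op (η.app (op U) (algebraMap A (Loc U) x)) =
      η.app (op V) (algebraMap A (Loc V) x) := by
  rw [← locRes_algebraMap h]
  exact (ConcreteCategory.congr_hom (η.naturality (homOfLE h).op) (algebraMap A (Loc U) x)).symm

theorem germ_app_algebraMap (p : PrimeSpectrum A) {U : Opens (PrimeSpectrum A)} (hp : p ∈ U)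
    (x : A) : germ O p U hp (η.app (op U) (algebraMap A (Loc U) x)) = toStalk η p x := by
  rw [← map_app_algebraMap η (le_top : U ≤ ⊤)]
  exact germ_res O p (le_top : U ≤ ⊤) hp _

theorem bijective_app (hη : ∀ a : A, IsIso (η.app (op (PrimeSpectrum.basicOpen a)))) (a : A) :
    Function.Bijective (η.app (op (PrimeSpectrum.basicOpen a))) :=
  ConcreteCategory.bijective_of_isIso _

/-- Each axiom of localization is checked on a small `D(a)` containing `p`, where `O` is `S_a⁻¹ A`
and `S_a` avoids `p`. -/
theorem isLocalization_stalk (hη : ∀ a : A, IsIso (η.app (op (PrimeSpectrum.basicOpen a))))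
    (p : PrimeSpectrum A) :
    let := (toStalk η p).toAlgebra
    IsLocalization.AtPrime (stalk O p) p.asIdeal := by
  let := (toStalk η p).toAlgebra
  refine ⟨fun s => ?_, fun t => ?_, fun {x y} h => ?_⟩
  · have hs : p ∈ PrimeSpectrum.basicOpen s.1 := s.2
    have hu : IsUnit (algebraMap A (Loc (PrimeSpectrum.basicOpen s.1)) s.1) :=
      IsLocalization.map_units _ (⟨s.1, le_refl (PrimeSpectrum.basicOpen s.1)⟩ :
        nonvanishing (PrimeSpectrum.basicOpen s.1))
    have := (hu.map (η.app (op (PrimeSpectrum.basicOpen s.1))).hom).map (germ O p _ hs).hom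
    rwa [show algebraMap A (stalk O p) s.1 = _ from (germ_app_algebraMap η p hs s.1).symm]
  · obtain ⟨U, hpU, t, rfl⟩ := exists_germ_eq O p t
    obtain ⟨a, hpa, haU⟩ := exists_basicOpen_le hpU
    obtain ⟨(z : Loc (PrimeSpectrum.basicOpen a)), hz⟩ := (bijective_app η hη a).2 (O.map (homOfLE haU).op t)
    obtain ⟨⟨x, s⟩, hxs⟩ := IsLocalization.surj (nonvanishing (PrimeSpectrum.basicOpen a)) z
    refine ⟨(x, ⟨s.1, nonvanishing_le_primeCompl hpa s.2⟩), ?_⟩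
    let ψ : Loc (PrimeSpectrum.basicOpen a) →+* stalk O p :=
      (germ O p _ hpa).hom.comp (η.app (op (PrimeSpectrum.basicOpen a))).hom
    have e := (map_mul ψ _ _).symm.trans (congr_arg ψ hxs)
    rw [← germ_res O p haU hpa, ← hz]
    exact (congr_arg _ (germ_app_algebraMap η p hpa s.1).symm).trans
      (e.trans (germ_app_algebraMap η p hpa x))
  · replace h : toStalk η p x = toStalk η p y := h
    rw [← germ_app_algebraMap η p (show p ∈ (⊤ : Opens (PrimeSpectrum A)) from trivial),
      ← germ_app_algebraMap η p (show p ∈ (⊤ : Opens (PrimeSpectrum A)) from trivial)] at h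
    obtain ⟨W, hpW, k, l, e⟩ := exists_res_eq_of_germ_eq O p _ _ _ _ h
    obtain ⟨a, hpa, haW⟩ := exists_basicOpen_le hpW
    rw [map_app_algebraMap, map_app_algebraMap] at e
    -- Restricted to `D(a)`, the equality of sections pulls back along the injective `η` to `S_a⁻¹
    -- A`, which yields the multiplier `c`.
    have e' := congr_arg (O.map (homOfLE haW).op) e
    rw [map_app_algebraMap, map_app_algebraMap] at e'
    obtain ⟨c, hc⟩ := (IsLocalization.eq_iff_exists (nonvanishing (PrimeSpectrum.basicOpen a))
      (Loc (PrimeSpectrum.basicOpen a))).1 ((bijective_app η hη a).1 e')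
    exact ⟨⟨c.1, nonvanishing_le_primeCompl hpa c.2⟩, hc⟩

theorem isLocalizationPresheaf_of_isIso
    (hη : ∀ a : A, IsIso (η.app (op (PrimeSpectrum.basicOpen a)))) :
    IsLocalizationPresheaf O η where
  isIso_away a := by
    have := isIso_of_bijective (CommSemiRingCat.ofHom (awayToLoc a)) (awayToLoc_bijective a)
    exact IsIso.comp_isIso' this (hη a)
  isIso_global := by
    have h₁ := isIso_of_bijective (CommSemiRingCat.ofHom
      (algebraMap A (Loc (⊤ : Opens (PrimeSpectrum A))))) (algebraMap_loc_top_bijective A)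
    -- `X = D(1)`, so the global case is an instance of the principal one.
    have h₂ := hη 1
    rw [PrimeSpectrum.basicOpen_one] at h₂
    exact IsIso.comp_isIso' h₁ h₂
  stalk_iso p := by
    let := (toStalk η p).toAlgebra
    have := isLocalization_stalk η hη p
    let e := IsLocalization.algEquiv p.asIdeal.primeCompl (Localization.AtPrime p.asIdeal)
      (stalk O p)
    refine ⟨RingEquiv.toCommSemiRingCatIso e.toRingEquiv, ?_⟩
    ext x
    exact e.commutes x
  isLocalRing_stalk p := by
    let := (toStalk η p).toAlgebra
    have := isLocalization_stalk η hη p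
    exact IsLocalization.AtPrime.isLocalRing (stalk O p) p.asIdeal

end Stalk

end

end SemiringSpec

theorem mainTheorem1 (A : Type u) [CommSemiring A] :
    -- the three constructions are sheaves
    (SemiringSpec.sheafA A).IsSheaf ∧
    (SemiringSpec.sheafB A).IsSheaf ∧
    (SemiringSpec.sheafC A).IsSheaf ∧
    -- the second one is computed by any covering by principal open sets
    (∀ (U : Opens (PrimeSpectrum A)) (ι : Type v) (a : ι → A)
      (h : ∀ i, PrimeSpectrum.basicOpen (a i) ≤ U),
      U = ⨆ i, PrimeSpectrum.basicOpen (a i) →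
      Function.Bijective (SemiringSpec.sectionsBToEqualizer U a h)) ∧
    -- the three constructions are isomorphic, compatibly with the maps from `U ↦ S_U⁻¹ A`
    (∃ (e₁ : SemiringSpec.sheafA A ≅ SemiringSpec.sheafB A)
      (e₂ : SemiringSpec.sheafA A ≅ SemiringSpec.sheafC A)
      (e₃ : SemiringSpec.sheafB A ≅ SemiringSpec.sheafC A),
      SemiringSpec.toSheafA A ≫ e₁.hom = SemiringSpec.toSheafB A ∧
      SemiringSpec.toSheafA A ≫ e₂.hom = SemiringSpec.toSheafC A ∧
      SemiringSpec.toSheafB A ≫ e₃.hom = SemiringSpec.toSheafC A) ∧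
    -- sections on principal open sets, global sections and stalks
    SemiringSpec.IsLocalizationPresheaf (SemiringSpec.sheafA A) (SemiringSpec.toSheafA A) ∧
    SemiringSpec.IsLocalizationPresheaf (SemiringSpec.sheafB A) (SemiringSpec.toSheafB A) ∧
    SemiringSpec.IsLocalizationPresheaf (SemiringSpec.sheafC A) (SemiringSpec.toSheafC A) := by

  refine ⟨SemiringSpec.isSheaf_sheafA A, SemiringSpec.isSheaf_sheafB A,
    SemiringSpec.isSheaf_sheafC A,
    fun U ι a h hU => SemiringSpec.sectionsBToEqualizer_bijective U a h hU.le, ?_,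
    SemiringSpec.isLocalizationPresheaf_of_isIso _ inferInstance,
    SemiringSpec.isLocalizationPresheaf_of_isIso _ inferInstance,
    SemiringSpec.isLocalizationPresheaf_of_isIso _ inferInstance⟩
  obtain ⟨e₁, h₁⟩ := SemiringSpec.exists_iso_sheafA (SemiringSpec.isSheaf_sheafB A)
    (SemiringSpec.toSheafB A) inferInstance
  obtain ⟨e₂, h₂⟩ := SemiringSpec.exists_iso_sheafA (SemiringSpec.isSheaf_sheafC A)
    (SemiringSpec.toSheafC A) inferInstance
  refine ⟨e₁, e₂, (SemiringSpec.sheafCIsoSheafB A).symm, h₁, h₂, ?_⟩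
  rw [Iso.symm_hom, Iso.comp_inv_eq, SemiringSpec.toSheafC_comp_sheafCIsoSheafB_hom]
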